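/- \textbf{Setting.} Consider a control system $dx_t=(f(x_t)+g(x_t)u_t)\,dt+\sigma(x_t)\,dW_t$ with states in an open set $\mathcal X\subseteq\mathbb R^{n}$ and controls in $\mathcal U\subseteq\mathbb R^{m}$, on a filtered probability space $(\Omega,\mathcal F,\{\mathcal F_t\}_{t\ge 0},\mathbb P)$ satisfying the usual conditions, where $W$ is a $k$-dimensional $\{\mathcal F_t\}$-Brownian motion started at $0$ and $u$ is a progressively measurable $\mathcal U$-valued process. A $C^2$ function $h:\mathcal X\to\mathbb R$ is a (stochastic) zero control barrier function (ZCBF) for the system if for every $x\in\mathcal X$ with $h(x)>0$ there is $u\in\mathcal U$ with $$\frac{\partial h}{\partial x}\big(f(x)+g(x)u\big)+\tfrac12\operatorname{Tr}\Big(\sigma(x)^{\mathsf T}\frac{\partial^2h}{\partial x^2}\sigma(x)\Big)\ \ge\ -h(x).\qquad(\ast)$$ Put $\mathcal C=\{x\in\mathcal X: h(x)\ge 0\}$. The \emph{almost-sure safety guarantee} for the system and $h$ is the assertion: for every such probability space, Brownian motion, control process $u$ and solution $x$ of the SDE such that, almost surely, $x_0\in\mathcal C$ and $u_t$ satisfies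 $(\ast)$ at $x=x_t$ for all $t\ge0$ with $h(x_t)>0$, one has $\mathbb P(x_t\in\mathcal C\ \text{for all } t\ge0)=1$. \textbf{Statement (uncontrolled Brownian motion).} Let $\mathcal X=\mathbb R$, let $\mathcal U\subseteq\mathbb R^m$ be any nonempty set, and take $f=0$, $g=0$, $\sigma=1$ and $h(x)=x$. Then: (i) $h$ is a ZCBF for this system, for all $x$ and $u$ the inequality $(\ast)$ reduces to $0\ge -h(x)$, and $\mathcal C=\{x: x\ge0\}$. (ii) For every filtered probability space satisfying the usual conditions and every Brownian motion $W$ on it: for every control process $u$, the process $x_t=W_t$ is a solution of the SDE and, almost surely, $u_t$ satisfies $(\ast)$ at $x=W_t$ for all $t\ge0$ with $h(W_t)>0$; moreover $W_0\in\mathcal C$ almost surely and $W_t\sim N(0,t)$ for all $t\ge 0$; but $\mathbb P(W_t\ge0\ \text{for all } t\ge0)\ne1$. (iii) Consequently the almost-sure safety guarantee fails for this system and this $h$, and so the claim that the almost-sure safety guarantee holds for every system and every ZCBF $h$ for it is false. -/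

import Mathlib

open MeasureTheory ProbabilityTheory Filter Topology
open scoped NNReal ENNReal Matrix

namespace StochCBF

/-! ### Filtered probability spaces, Brownian motion, the Itô integral -/

/-- The usual conditions: the probability measure is complete, every null set belongs to `F 0`
(hence to every `F t`), and the filtration is right-continuous. -/
structure UsualConditions {Ω : Type*} {mΩ : MeasurableSpace Ω}
    (F : Filtration ℝ≥0 mΩ) (P : Measure Ω) : Prop where
  complete : P.IsComplete
  null_mem : ∀ s : Set Ω, P s = 0 → MeasurableSet[F 0] s
  rightContinuous : F.IsRightContinuous

/-- `W` is a standard `k`-dimensional Brownian motion with respect to the filtration `F`: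
it is adapted, its coordinates are independent real Brownian motions (started at `0`, with almost
surely continuous paths), and `W t - W s` is independent of `F s` for `s ≤ t`. -/
structure IsBrownianMotion {Ω : Type*} {mΩ : MeasurableSpace Ω} {k : ℕ}
    (F : Filtration ℝ≥0 mΩ) (P : Measure Ω) (W : ℝ≥0 → Ω → (Fin k → ℝ)) : Prop where
  adapted : Adapted F W
  coord : ∀ j, IsBrownianReal (fun t ω => W t ω j) P
  indep_coord : iIndepFun (fun (j : Fin k) (ω : Ω) (t : ℝ≥0) => W t ω j) P
  indep_increment : ∀ s t : ℝ≥0, s ≤ t →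
    Indep (MeasurableSpace.comap (fun ω => W t ω - W s ω) inferInstance) (F s) P

/-- A simple predictable process `∑ k < n, ξ k • 1_{(τ k, τ (k + 1)]}` with deterministic times and
bounded `F (τ k)`-measurable coefficients `ξ k`. -/
structure SimpleIntegrand {Ω : Type*} {mΩ : MeasurableSpace Ω} (F : Filtration ℝ≥0 mΩ) where
  n : ℕ
  τ : ℕ → ℝ≥0
  ξ : ℕ → Ω → ℝ
  mono : Monotone τ
  measurable : ∀ k, Measurable[F (τ k)] (ξ k)
  bounded : ∃ M : ℝ, ∀ k ω, |ξ k ω| ≤ M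

/-- The value at time `t` of a simple process. -/
noncomputable def SimpleIntegrand.toFun {Ω : Type*} {mΩ : MeasurableSpace Ω}
    {F : Filtration ℝ≥0 mΩ} (S : SimpleIntegrand F) (t : ℝ≥0) (ω : Ω) : ℝ :=
  ∑ k ∈ Finset.range S.n, (Set.Ioc (S.τ k) (S.τ (k + 1))).indicator (fun _ => S.ξ k ω) t

/-- The elementary stochastic integral `∫₀ᵗ S dB` of a simple process. -/
noncomputable def SimpleIntegrand.integral {Ω : Type*} {mΩ : MeasurableSpace Ω}
    {F : Filtration ℝ≥0 mΩ} (S : SimpleIntegrand F) (B : ℝ≥0 → Ω → ℝ) (t : ℝ≥0) (ω : Ω) : ℝ :=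
  ∑ k ∈ Finset.range S.n, S.ξ k ω * (B (min t (S.τ (k + 1))) ω - B (min t (S.τ k)) ω)

/-- `I` is (a version of) the Itô integral process `I t = ∫₀ᵗ H dB` with respect to the real
`F`-Brownian motion `B`. The integrand `H` is progressively measurable with
`∫₀ᵗ H² ds < ∞` almost surely, and `I` is the adapted, almost surely continuous process with
`∫₀ᵗ Hₙ dB → I t` in probability for every `t`, where `Hₙ` are simple processes such that
`∫₀ᵗ (Hₙ - H)² ds → 0` in probability for every `t`. (These properties determine `I` up to
indistinguishability.) -/
structure IsItoIntegral {Ω : Type*} {mΩ : MeasurableSpace Ω}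
    (F : Filtration ℝ≥0 mΩ) (P : Measure Ω) (B H I : ℝ≥0 → Ω → ℝ) : Prop where
  progressive : IsProgressive F H
  sq_integrable : ∀ᵐ ω ∂P, ∀ t : ℝ≥0,
    ∫⁻ s in Set.Ioc (0 : ℝ) t, ENNReal.ofReal (H s.toNNReal ω ^ 2) < ∞
  adapted : Adapted F I
  continuous : ∀ᵐ ω ∂P, Continuous (fun t => I t ω)
  approx : ∃ S : ℕ → SimpleIntegrand F,
    (∀ t : ℝ≥0, ∀ ε : ℝ≥0∞, 0 < ε → Tendsto (fun n => P {ω | ε ≤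
      ∫⁻ s in Set.Ioc (0 : ℝ) t,
        ENNReal.ofReal (((S n).toFun s.toNNReal ω - H s.toNNReal ω) ^ 2)}) atTop (𝓝 0)) ∧
    (∀ t : ℝ≥0, TendstoInMeasure P (fun n => (S n).integral B t) atTop (I t))

/-! ### Control-affine stochastic systems -/

/-- The data of the stochastic control system `dx = (f(x) + g(x) u) dt + σ(x) dW` with
states in the open set `X ⊆ ℝⁿ`, controls in `U ⊆ ℝᵐ`, and a `k`-dimensional noise `W`.
The values of `f`, `g`, `σ` outside of `X` play no role. -/
structure ControlSystem (n m k : ℕ) where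
  X : Set (Fin n → ℝ)
  U : Set (Fin m → ℝ)
  f : (Fin n → ℝ) → (Fin n → ℝ)
  g : (Fin n → ℝ) → Matrix (Fin n) (Fin m) ℝ
  σ : (Fin n → ℝ) → Matrix (Fin n) (Fin k) ℝ
  isOpen_X : IsOpen X

/-- The drift `f(x) + g(x) u`. -/
def ControlSystem.drift {n m k : ℕ} (S : ControlSystem n m k)
    (x : Fin n → ℝ) (u : Fin m → ℝ) : Fin n → ℝ :=
  S.f x + S.g x *ᵥ u

/-- An admissible control process: progressively measurable with values in `U`. -/
structure IsControl {Ω : Type*} {mΩ : MeasurableSpace Ω} {n m k : ℕ} (S : ControlSystem n m k)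
    (F : Filtration ℝ≥0 mΩ) (u : ℝ≥0 → Ω → (Fin m → ℝ)) : Prop where
  progressive : IsProgressive F u
  mem : ∀ t ω, u t ω ∈ S.U

/-- `x` is a (global) solution of `dx = (f(x) + g(x) u) dt + σ(x) dW`, that is, `x` is an adapted
process with continuous paths in `X` and, almost surely, for all `t ≥ 0`,
`x t = x 0 + ∫₀ᵗ (f(x) + g(x) u) ds + ∫₀ᵗ σ(x) dW`. -/
structure IsSolution {Ω : Type*} {mΩ : MeasurableSpace Ω} {n m k : ℕ} (S : ControlSystem n m k)
    (F : Filtration ℝ≥0 mΩ) (P : Measure Ω) (W : ℝ≥0 → Ω → (Fin k → ℝ))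
    (u : ℝ≥0 → Ω → (Fin m → ℝ)) (x : ℝ≥0 → Ω → (Fin n → ℝ)) : Prop where
  adapted : Adapted F x
  continuous : ∀ᵐ ω ∂P, Continuous (fun t => x t ω)
  mem : ∀ᵐ ω ∂P, ∀ t, x t ω ∈ S.X
  drift_integrable : ∀ᵐ ω ∂P, ∀ (t : ℝ≥0) (i : Fin n), IntervalIntegrable
    (fun s : ℝ => S.drift (x s.toNNReal ω) (u s.toNNReal ω) i) volume 0 t
  integral_eq : ∃ I : Fin n → Fin k → ℝ≥0 → Ω → ℝ,
    (∀ i j, IsItoIntegral F P (fun t ω => W t ω j) (fun t ω => S.σ (x t ω) i j) (I i j)) ∧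
    ∀ᵐ ω ∂P, ∀ (t : ℝ≥0) (i : Fin n), x t ω i = x 0 ω i
      + (∫ s in (0 : ℝ)..t, S.drift (x s.toNNReal ω) (u s.toNNReal ω) i)
      + ∑ j, I i j t ω

/-! ### Zero control barrier functions -/

/-- The Hessian matrix of `h` at `x`. -/
noncomputable def hessian {n : ℕ} (h : (Fin n → ℝ) → ℝ) (x : Fin n → ℝ) :
    Matrix (Fin n) (Fin n) ℝ :=
  Matrix.of fun i j =>
    fderiv ℝ (fun y => fderiv ℝ h y (Pi.single j 1)) x (Pi.single i 1)

/-- The inequality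
`∂h/∂x (f(x) + g(x) u) + (1/2) Tr(σᵀ (∂²h/∂x²) σ) ≥ -h(x)`. -/
def ZCBFInequality {n m k : ℕ} (S : ControlSystem n m k) (h : (Fin n → ℝ) → ℝ)
    (x : Fin n → ℝ) (u : Fin m → ℝ) : Prop :=
  fderiv ℝ h x (S.drift x u) + 1 / 2 * ((S.σ x)ᵀ * hessian h x * S.σ x).trace ≥ -h x

/-- `h` is a (stochastic) zero-CBF for the system: it is `C²` on `X`, and for every state `x` with
`h x > 0` some control `u ∈ U` satisfies the ZCBF inequality. -/
structure IsZCBF {n m k : ℕ} (S : ControlSystem n m k) (h : (Fin n → ℝ) → ℝ) : Prop where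
  contDiffOn : ContDiffOn ℝ 2 h S.X
  exists_control : ∀ x ∈ S.X, h x > 0 → ∃ u ∈ S.U, ZCBFInequality S h x u

/-- The safe region `C = {x ∈ X | h x ≥ 0}`. -/
def safeSet {n m k : ℕ} (S : ControlSystem n m k) (h : (Fin n → ℝ) → ℝ) : Set (Fin n → ℝ) :=
  {x | x ∈ S.X ∧ h x ≥ 0}

/-- Along the process, the control satisfies the ZCBF inequality at each time
(at which `h (x t) > 0`, the range in which the ZCBF condition is imposed). -/
def ControlSatisfiesZCBF {Ω : Type*} {mΩ : MeasurableSpace Ω} {n m k : ℕ}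
    (S : ControlSystem n m k) (h : (Fin n → ℝ) → ℝ) (P : Measure Ω)
    (u : ℝ≥0 → Ω → (Fin m → ℝ)) (x : ℝ≥0 → Ω → (Fin n → ℝ)) : Prop :=
  ∀ᵐ ω ∂P, ∀ t, h (x t ω) > 0 → ZCBFInequality S h (x t ω) (u t ω)

/-- The almost-sure safety guarantee for the system `S` and the function `h`: whenever `x` solves
the controlled SDE, the control satisfies the ZCBF inequality at each time, and `x 0 ∈ C`, then
`Pr(x t ∈ C for all t ≥ 0) = 1`. -/
def AlmostSureSafety {n m k : ℕ} (S : ControlSystem n m k) (h : (Fin n → ℝ) → ℝ) : Prop :=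
  ∀ (Ω : Type) (mΩ : MeasurableSpace Ω) (F : Filtration ℝ≥0 mΩ) (P : Measure Ω),
    IsProbabilityMeasure P → UsualConditions F P →
    ∀ (W : ℝ≥0 → Ω → (Fin k → ℝ)) (u : ℝ≥0 → Ω → (Fin m → ℝ)) (x : ℝ≥0 → Ω → (Fin n → ℝ)),
      IsBrownianMotion F P W → IsControl S F u → IsSolution S F P W u x →
      ControlSatisfiesZCBF S h P u x → (∀ᵐ ω ∂P, x 0 ω ∈ safeSet S h) →
      P {ω | ∀ t, x t ω ∈ safeSet S h} = 1

/-- The claim that every stochastic ZCBF guarantees almost-sure safety. -/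
def ZCBFSafetyClaim : Prop :=
  ∀ (n m k : ℕ) (S : ControlSystem n m k) (h : (Fin n → ℝ) → ℝ),
    IsZCBF S h → AlmostSureSafety S h

/-! ### The example -/

/-- Uncontrolled Brownian motion: `X = ℝ`, `f = 0`, `g = 0`, `σ = 1`, with an arbitrary
control set `U`. -/
def brownianSystem {m : ℕ} (U : Set (Fin m → ℝ)) : ControlSystem 1 m 1 where
  X := Set.univ
  U := U
  f := fun _ => 0
  g := fun _ => 0
  σ := fun _ => 1
  isOpen_X := isOpen_univ

/-- The function `h(x) = x` on `ℝ`. -/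
def identityBarrier (x : Fin 1 → ℝ) : ℝ := x 0

end StochCBF

open StochCBF

/-! Drift and Hessian term both vanish, so the ZCBF inequality reads `h x ≥ 0` and is imposed only
where `h x > 0`: it is free there and says nothing at the boundary. Brownian motion solves the
equation because the Itô integral of `1` is `W` itself (`isItoIntegral_one`), yet at time `1` its
law charges the negative half-line (`measure_forall_nonneg_ne_one`).

Refuting the guarantee also requires one filtered space that carries a Brownian motion; otherwise
the guarantee would hold vacuously. Most of the proof builds it (`exists_isBrownianMotion`). An
isometry from `L²(ℝ)` into centred Gaussian variables (`exists_isonormal`), applied to the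
indicators of `(0, t]`, gives the Brownian covariance. Fourth moments of dyadic increments give
almost sure geometric decay (`ae_dyadic_increment_le`), hence a continuous modification
(`exists_continuous_dyadic_limit`, `ae_tendsto_dyadic`). Completion, augmentation by null sets and
right limits yield the usual conditions, and path continuity keeps the increments independent of the
enlarged past (`indep_increment_rightCont`). -/

namespace StochCBF

/-! ### Gaussian Hilbert spaces and pre-Brownian motion -/

/-- The characteristic function of the law of an `L²` random variable depends continuously on the
random variable. -/
lemma continuous_charFun_map_Lp {Ω : Type*} {mΩ : MeasurableSpace Ω} (P : Measure Ω)
    [IsProbabilityMeasure P] (t : ℝ) :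
    Continuous (fun X : Lp ℝ 2 P => charFun (P.map X) t) := by
  have hint (X : Lp ℝ 2 P) : Integrable X P := (Lp.memLp X).integrable (by norm_num)
  have hexp (X : Lp ℝ 2 P) : Integrable (fun ω => Complex.exp (t * X ω * Complex.I)) P := by
    refine Integrable.of_bound (C := 1) ?_ (ae_of_all _ fun ω => ?_)
    · exact (by fun_prop : Continuous fun x : ℝ => Complex.exp (t * x * Complex.I)).comp_aestronglyMeasurable
        (Lp.aestronglyMeasurable X)
    · rw [← Complex.ofReal_mul, Complex.norm_exp_ofReal_mul_I]
  have hchar (X : Lp ℝ 2 P) : charFun (P.map X) t = ∫ ω, Complex.exp (t * X ω * Complex.I) ∂P := by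
    rw [charFun_apply_real, integral_map (Lp.aestronglyMeasurable X).aemeasurable]
    exact (by fun_prop : Continuous fun x : ℝ => Complex.exp (t * x * Complex.I)).aestronglyMeasurable
  -- The map `x ↦ exp (i t x)` is `|t|`-Lipschitz, and the `L¹` norm is at most the `L²` norm under
  -- a probability measure.
  have hlip : LipschitzWith ‖t‖₊ (fun X : Lp ℝ 2 P => charFun (P.map X) t) := by
    refine LipschitzWith.of_dist_le_mul fun X Y => ?_
    rw [dist_eq_norm, hchar, hchar, ← integral_sub (hexp X) (hexp Y)]
    calc ‖∫ ω, (Complex.exp (t * X ω * Complex.I) - Complex.exp (t * Y ω * Complex.I)) ∂P‖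
        ≤ ∫ ω, |t| * ‖(X - Y : Lp ℝ 2 P) ω‖ ∂P := by
          refine norm_integral_le_of_norm_le ((hint _).norm.const_mul _) ?_
          filter_upwards [Lp.coeFn_sub X Y] with ω hω
          rw [hω, Pi.sub_apply, Real.norm_eq_abs, ← abs_mul, mul_sub]
          have h1 : Complex.exp (t * X ω * Complex.I) - Complex.exp (t * Y ω * Complex.I)
              = Complex.exp ((t * Y ω : ℝ) * Complex.I) *
                (Complex.exp (Complex.I * (t * X ω - t * Y ω : ℝ)) - 1) := by
            rw [mul_sub, ← Complex.exp_add]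
            push_cast
            ring_nf
          rw [h1, norm_mul, Complex.norm_exp_ofReal_mul_I, one_mul, ← Real.norm_eq_abs]
          exact Real.norm_exp_I_mul_ofReal_sub_one_le
      _ = |t| * ∫ ω, ‖(X - Y : Lp ℝ 2 P) ω‖ ∂P := integral_const_mul _ _
      _ ≤ |t| * ‖X - Y‖ := by
          gcongr
          rw [Lp.norm_def, integral_norm_eq_lintegral_enorm (Lp.aestronglyMeasurable _),
            ← eLpNorm_one_eq_lintegral_enorm]
          refine ENNReal.toReal_mono (Lp.eLpNorm_ne_top _) ?_
          exact eLpNorm_le_eLpNorm_of_exponent_le (by norm_num) (Lp.aestronglyMeasurable _)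
      _ = ‖t‖₊ * dist X Y := by rw [dist_eq_norm]; simp
  exact hlip.continuous

/-- A Gaussian family indexed by a Hilbert space whose covariance is the inner product. -/
theorem exists_isonormal (H : Type) [NormedAddCommGroup H] [InnerProductSpace ℝ H]
    [CompleteSpace H] :
    ∃ (Ω : Type) (_ : MeasurableSpace Ω) (P : Measure Ω) (_ : IsProbabilityMeasure P)
      (Φ : H →ₗᵢ[ℝ] Lp ℝ 2 P), ∀ h, P.map (Φ h) = gaussianReal 0 (‖h‖₊ ^ 2) := by
  classical
  obtain ⟨w, b, -⟩ := exists_hilbertBasis ℝ H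
  obtain ⟨Ω, mΩ, P, Z, hZm, hZ, hind, hP⟩ := exists_iid w (gaussianReal 0 1)
  have hL (i : w) : MemLp (Z i) 2 P := (hZ i).hasGaussianLaw.memLp_two
  have hmean (i : w) : ∫ ω, Z i ω ∂P = 0 := by
    rw [(hZ i).integral_eq, integral_id_gaussianReal]
  set e : w → Lp ℝ 2 P := fun i => (hL i).toLp with he
  have hinner (i j : w) : inner ℝ (e i) (e j) = ∫ ω, Z i ω * Z j ω ∂P := by
    rw [L2.inner_def]
    refine integral_congr_ae ?_
    filter_upwards [(hL i).coeFn_toLp, (hL j).coeFn_toLp] with ω h1 h2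
    simp [he, h1, h2, mul_comm]
  have horth : Orthonormal ℝ e := by
    rw [orthonormal_iff_ite]
    intro i j
    rw [hinner]
    split_ifs with hij
    · subst hij
      have h := (hZ i).variance_eq
      rw [variance_id_gaussianReal, variance_of_integral_eq_zero (hZ i).aemeasurable (hmean i)] at h
      simpa [sq] using h
    · have := (hind.indepFun hij).integral_fun_mul_eq_mul_integral
        (hL i).1 (hL j).1
      rw [this, hmean, zero_mul]
  set Ψ : lp (fun _ : w => ℝ) 2 →ₗᵢ[ℝ] Lp ℝ 2 P := horth.orthogonalFamily.linearIsometry with hΨ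
  set Φ : H →ₗᵢ[ℝ] Lp ℝ 2 P := Ψ.comp b.repr.toLinearIsometry with hΦ
  have hΦb (i : w) : Φ (b i) = e i := by
    simp only [hΦ, hΨ, LinearIsometry.coe_comp, Function.comp_apply,
      LinearIsometryEquiv.coe_toLinearIsometry, b.repr_self]
    rw [OrthogonalFamily.linearIsometry_apply_single]
    simp
  refine ⟨Ω, mΩ, P, hP, Φ, ?_⟩
  -- On finite combinations of basis vectors the image is a sum of independent Gaussians; both sides
  -- are continuous in `h`, so density of the span finishes.
  have key (t : ℝ) : (fun h : H => charFun (P.map (Φ h)) t) =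
      fun h => Complex.exp (-(((‖h‖ ^ 2 : ℝ) * t ^ 2 / 2 : ℂ))) := by
    have hdense : Dense (Submodule.span ℝ (Set.range b) : Set H) := by
      rw [Submodule.dense_iff_topologicalClosure_eq_top]
      exact b.dense_span
    refine Continuous.ext_on hdense
      ((continuous_charFun_map_Lp P t).comp Φ.continuous) (by fun_prop) ?_
    intro h hh
    obtain ⟨c, rfl⟩ := (Finsupp.mem_span_range_iff_exists_finsupp).1 hh
    have hsum : Φ (c.sum fun i a => a • b i) =ᵐ[P] fun ω => ∑ i : c.support, c i * Z i ω := by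
      have h1 : Φ (c.sum fun i a => a • b i) = ∑ i ∈ c.support, c i • e i := by
        simp [Finsupp.sum, map_sum, hΦb]
      rw [h1]
      have h2 : ∀ᵐ ω ∂P, ∀ i : c.support, (c i • e i : Lp ℝ 2 P) ω = c i * Z i ω := by
        refine ae_all_iff.2 fun i => ?_
        filter_upwards [Lp.coeFn_smul (c i) (e i), (hL i).coeFn_toLp] with ω h3 h4
        rw [h3, Pi.smul_apply, smul_eq_mul, h4]
      filter_upwards [h2, Lp.coeFn_fun_finsetSum c.support (fun i => c i • e i)] with ω h3 h4
      rw [h4, ← Finset.sum_coe_sort]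
      exact Finset.sum_congr rfl fun i _ => h3 i
    set X := Φ (c.sum fun i a => a • b i) with hX
    have hg : HasGaussianLaw X P := by
      refine HasGaussianLaw.congr ?_ hsum.symm
      refine iIndepFun.hasGaussianLaw_fun_sum (X := fun (i : c.support) ω => c i * Z i ω)
        (fun i => (hZ i).hasGaussianLaw.fun_smul (c i)) ?_
      exact (hind.precomp (g := fun i : c.support => (i : w)) Subtype.val_injective).comp
        (fun i x => c i * x) (fun i => measurable_const_mul _)
    have hm : ∫ ω, X ω ∂P = 0 := by
      rw [integral_congr_ae hsum, integral_finsetSum (s := Finset.univ)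
        (f := fun (i : c.support) ω => c i * Z i ω)
        fun i _ => ((hL i).integrable (by norm_num)).const_mul _]
      simp [integral_const_mul, hmean]
    have hv : Var[X; P] = ‖(c.sum fun i a => a • b i)‖ ^ 2 := by
      rw [variance_of_integral_eq_zero hg.aemeasurable hm, ← Φ.norm_map, ← hX,
        ← real_inner_self_eq_norm_sq, L2.inner_def]
      simp [sq]
    simp only
    rw [hg.map_eq_gaussianReal, charFun_gaussianReal, hm, hv,
      Real.coe_toNNReal _ (by positivity)]
    congr 1
    push_cast
    ring
  intro h
  have : IsProbabilityMeasure (P.map (Φ h)) :=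
    Measure.isProbabilityMeasure_map (Lp.aestronglyMeasurable _).aemeasurable
  refine Measure.ext_of_charFun (funext fun t => ?_)
  rw [congrFun (key t) h, charFun_gaussianReal]
  congr 1
  push_cast
  simp

/-- There is a pre-Brownian motion. -/
theorem exists_isPreBrownianReal :
    ∃ (Ω : Type) (_ : MeasurableSpace Ω) (P : Measure Ω) (X : ℝ≥0 → Ω → ℝ),
      (∀ t, Measurable (X t)) ∧ IsPreBrownianReal X P := by
  obtain ⟨Ω, mΩ, P, hP, Φ, hΦ⟩ := exists_isonormal (Lp ℝ 2 (volume : Measure ℝ))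
  obtain ⟨f, hf⟩ : ∃ f : ℝ≥0 → Lp ℝ 2 (volume : Measure ℝ),
      ∀ s t, s ≤ t → inner ℝ (f s) (f t) = (s : ℝ) := by
    -- The inner product of the indicators of `(0, s]` and `(0, t]` is the length of the overlap,
    -- `min s t`.
    refine ⟨fun t => indicatorConstLp 2 (measurableSet_Ioc (a := (0 : ℝ)) (b := t)) (by simp) 1,
      fun s t hst => ?_⟩
    have h : Set.Ioc (0 : ℝ) s ∩ Set.Ioc (0 : ℝ) t = Set.Ioc (0 : ℝ) s :=
      Set.inter_eq_left.2 (Set.Ioc_subset_Ioc_right (by exact_mod_cast hst))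
    rw [L2.inner_indicatorConstLp_indicatorConstLp measurableSet_Ioc measurableSet_Ioc
      (by simp) (by simp), h]
    simp
  have hmean (h) : ∫ ω, Φ h ω ∂P = 0 := by
    have : ∫ x, x ∂(P.map (Φ h)) = 0 := by rw [hΦ, integral_id_gaussianReal]
    rwa [integral_map (Lp.aestronglyMeasurable _).aemeasurable (by fun_prop)] at this
  refine ⟨Ω, mΩ, P, fun t => Φ (f t), fun t => (Lp.stronglyMeasurable _).measurable, ?_⟩
  refine IsGaussianProcess.isPreBrownianReal_of_covariance ⟨fun I => ⟨?_⟩⟩ (fun t => hmean _) ?_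
  · have hmeas : Measurable fun ω => I.restrict fun t => Φ (f t) ω :=
      measurable_pi_lambda _ fun i => (Lp.stronglyMeasurable _).measurable
    -- Cramér–Wold: by linearity of `Φ`, each functional of the finite-dimensional vector is almost
    -- surely `Φ` of a single element of `L²(ℝ)`, hence Gaussian.
    refine isGaussian_of_map_eq_gaussianReal fun L => ⟨0, ‖∑ i : I, L (Pi.single i 1) • f i‖₊ ^ 2, ?_⟩
    rw [Measure.map_map (by fun_prop) hmeas, ← hΦ]
    refine Measure.map_congr ?_
    have h1 : Φ (∑ i : I, L (Pi.single i 1) • f i) = ∑ i : I, L (Pi.single i 1) • Φ (f i) := by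
      simp only [map_sum, map_smul]
    have h2 : ∀ᵐ ω ∂P, ∀ i : I, (L (Pi.single i 1) • Φ (f i) : Lp ℝ 2 P) ω
        = L (Pi.single i 1) * Φ (f i) ω :=
      ae_all_iff.2 fun i => Lp.coeFn_smul _ _
    rw [h1]
    filter_upwards [h2, Lp.coeFn_fun_finsetSum Finset.univ
      (fun i : I => L (Pi.single i 1) • Φ (f i))] with ω h3 h4
    rw [h4, Finset.sum_congr rfl fun i _ => h3 i, Function.comp_apply]
    conv_lhs => rw [← Finset.univ_sum_single (I.restrict fun t => Φ (f t) ω), map_sum]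
    refine Finset.sum_congr rfl fun i _ => ?_
    rw [← mul_one ((I.restrict fun t => Φ (f t) ω) i), ← smul_eq_mul, Pi.single_smul, map_smul,
      smul_eq_mul, mul_comm]
    rfl
  · intro s t hst
    rw [covariance_eq_sub (Lp.memLp _) (Lp.memLp _), hmean, zero_mul, sub_zero]
    have h1 : inner ℝ (Φ (f s)) (Φ (f t)) = ∫ ω, (Φ (f s) * Φ (f t) : Ω → ℝ) ω ∂P := by
      rw [L2.inner_def]
      exact integral_congr_ae (ae_of_all _ fun ω => by simp [mul_comm])
    rw [← h1, Φ.inner_map_map, hf s t hst]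

/-! ### Continuous modification by dyadic approximation -/

/-- A function whose increments over the dyadic intervals of level `n` are locally uniformly
`O(r ^ n)` has a continuous limit along the dyadic approximations of the argument. -/
lemma exists_continuous_dyadic_limit {x : ℝ≥0 → ℝ} {r : ℝ} (hr0 : 0 ≤ r) (hr1 : r < 1)
    (h : ∀ N : ℕ, ∃ C : ℝ, ∀ n k : ℕ, k ≤ N * 2 ^ n →
      |x ((k + 1 : ℕ) / 2 ^ n) - x (k / 2 ^ n)| ≤ C * r ^ n) :
    ∃ y : ℝ≥0 → ℝ, Continuous y ∧
      ∀ t, Tendsto (fun n : ℕ => x (⌊2 ^ n * t⌋₊ / 2 ^ n)) atTop (𝓝 (y t)) := by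
  choose C hC using h
  have hC0 (N : ℕ) : 0 ≤ C N := by
    simpa using (abs_nonneg _).trans (hC N 0 0 (by simp))
  have hfloor (N n : ℕ) (t : ℝ≥0) (ht : t ≤ N) : ⌊2 ^ n * t⌋₊ ≤ N * 2 ^ n := by
    refine Nat.floor_le_of_le ?_
    push_cast
    rw [mul_comm]
    gcongr
  have hstep (N : ℕ) (t : ℝ≥0) (ht : t ≤ N) (n : ℕ) :
      dist (x (⌊2 ^ n * t⌋₊ / 2 ^ n)) (x (⌊2 ^ (n + 1) * t⌋₊ / 2 ^ (n + 1))) ≤ C N * r ^ n := by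
    set j := ⌊2 ^ n * t⌋₊ with hj
    have h1 : (j : ℝ≥0) ≤ 2 ^ n * t := Nat.floor_le (by positivity)
    have h2 : 2 ^ n * t < j + 1 := Nat.lt_floor_add_one _
    have h3 : (j : ℝ≥0) / 2 ^ n = (2 * j : ℕ) / 2 ^ (n + 1) := by
      push_cast
      rw [pow_succ]
      field_simp
    -- Refining the grid keeps the approximating point or moves it right by one cell of level `n +
    -- 1`.
    have h4 : 2 * j ≤ ⌊2 ^ (n + 1) * t⌋₊ := by
      refine Nat.le_floor ?_
      push_cast
      rw [pow_succ', mul_assoc]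
      gcongr
    have h5 : ⌊2 ^ (n + 1) * t⌋₊ < 2 * j + 2 := by
      refine (Nat.floor_lt (by positivity)).2 ?_
      push_cast
      rw [pow_succ', mul_assoc]
      calc 2 * (2 ^ n * t) < 2 * (j + 1 : ℝ≥0) := by gcongr
        _ = _ := by ring
    obtain h6 | h6 : ⌊2 ^ (n + 1) * t⌋₊ = 2 * j ∨ ⌊2 ^ (n + 1) * t⌋₊ = 2 * j + 1 := by omega
    · rw [h6, h3, dist_self]
      exact mul_nonneg (hC0 N) (by positivity)
    · rw [h6, h3, dist_comm, Real.dist_eq]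
      refine (hC N (n + 1) (2 * j) ?_).trans ?_
      · have := hfloor N n t ht
        rw [pow_succ]
        lia
      · exact mul_le_mul_of_nonneg_left (pow_le_pow_of_le_one hr0 hr1.le n.le_succ) (hC0 N)
  have hlim (t : ℝ≥0) : ∃ y, Tendsto (fun n : ℕ => x (⌊2 ^ n * t⌋₊ / 2 ^ n)) atTop (𝓝 y) := by
    obtain ⟨N, hN⟩ := exists_nat_ge t
    exact cauchySeq_tendsto_of_complete (cauchySeq_of_le_geometric r (C N) hr1 (hstep N t hN))
  choose y hy using hlim
  have htail (N : ℕ) (t : ℝ≥0) (ht : t ≤ N) (n : ℕ) :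
      dist (x (⌊2 ^ n * t⌋₊ / 2 ^ n)) (y t) ≤ C N * r ^ n / (1 - r) :=
    dist_le_of_le_geometric_of_tendsto r (C N) hr1 (hstep N t ht) (hy t) n
  have hnear (N : ℕ) (s t : ℝ≥0) (hs : s ≤ N) (hst : s ≤ t) (n : ℕ)
      (hn : 2 ^ n * t ≤ 2 ^ n * s + 1) :
      dist (x (⌊2 ^ n * s⌋₊ / 2 ^ n)) (x (⌊2 ^ n * t⌋₊ / 2 ^ n)) ≤ C N * r ^ n := by
    have h1 : ⌊2 ^ n * s⌋₊ ≤ ⌊2 ^ n * t⌋₊ := Nat.floor_mono (by gcongr)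
    have h2 : ⌊2 ^ n * t⌋₊ ≤ ⌊2 ^ n * s⌋₊ + 1 := by
      rw [← Nat.floor_add_one (by positivity)]
      exact Nat.floor_mono hn
    obtain h6 | h6 : ⌊2 ^ n * t⌋₊ = ⌊2 ^ n * s⌋₊ ∨ ⌊2 ^ n * t⌋₊ = ⌊2 ^ n * s⌋₊ + 1 := by omega
    · rw [h6, dist_self]
      exact mul_nonneg (hC0 N) (by positivity)
    · rw [h6, dist_comm, Real.dist_eq]
      exact hC N n _ (hfloor N n s hs)
  -- Points at distance at most `2⁻ⁿ` are compared through their level `n` approximations: two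
  -- geometric tails and at most one increment.
  have hmod (N : ℕ) (s t : ℝ≥0) (hs : s ≤ N) (ht : t ≤ N) (hst : s ≤ t) (n : ℕ)
      (hn : 2 ^ n * t ≤ 2 ^ n * s + 1) :
      dist (y s) (y t) ≤ (C N * (1 + 2 / (1 - r))) * r ^ n := by
    have h1 := htail N s hs n
    have h2 := htail N t ht n
    have h3 := hnear N s t hs hst n hn
    have h4 := dist_triangle4 (y s) (x (⌊2 ^ n * s⌋₊ / 2 ^ n)) (x (⌊2 ^ n * t⌋₊ / 2 ^ n)) (y t)
    rw [dist_comm] at h1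
    calc dist (y s) (y t) ≤ _ := h4
      _ ≤ C N * r ^ n / (1 - r) + C N * r ^ n + C N * r ^ n / (1 - r) := by gcongr
      _ = _ := by ring
  refine ⟨y, Metric.continuous_iff.2 fun t ε hε => ?_, hy⟩
  obtain ⟨N, hN⟩ := exists_nat_ge (t + 1)
  have htend : Tendsto (fun n : ℕ => (C N * (1 + 2 / (1 - r))) * r ^ n) atTop (𝓝 0) := by
    simpa using (tendsto_pow_atTop_nhds_zero_of_lt_one hr0 hr1).const_mul (C N * (1 + 2 / (1 - r)))
  obtain ⟨n, hn⟩ := (htend.eventually (gt_mem_nhds hε)).exists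
  -- The cap `1` keeps `s` below `N ≥ t + 1`, where the constant `C N` applies.
  refine ⟨min 1 ((1 / 2) ^ n), by positivity, fun s hs => lt_of_le_of_lt ?_ hn⟩
  have hs1 : dist s t < 1 := hs.trans_le (min_le_left _ _)
  have hs2 : dist s t < (1 / 2) ^ n := hs.trans_le (min_le_right _ _)
  rw [NNReal.dist_eq, abs_lt] at hs1 hs2
  have htN : t ≤ N := le_self_add.trans hN
  have hsN : s ≤ N := by
    refine le_trans ?_ hN
    rw [← NNReal.coe_le_coe]
    push_cast
    linarith
  have hpow : (2 : ℝ) ^ n * (1 / 2) ^ n = 1 := by rw [← mul_pow]; norm_num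
  have h2n : (0 : ℝ) < 2 ^ n := by positivity
  rcases le_total s t with hst | hst
  · refine hmod N s t hsN htN hst n ?_
    rw [← NNReal.coe_le_coe]
    push_cast
    nlinarith
  · rw [dist_comm]
    refine hmod N t s htN hsN hst n ?_
    rw [← NNReal.coe_le_coe]
    push_cast
    nlinarith

/-- The fourth moment of a centered Gaussian variable with variance `v` is a multiple of `v ^ 2`. -/
lemma lintegral_enorm_pow_four_gaussianReal (v : ℝ≥0) :
    ∫⁻ x, ‖x‖ₑ ^ 4 ∂(gaussianReal 0 v) = v ^ 2 * ∫⁻ x, ‖x‖ₑ ^ 4 ∂(gaussianReal 0 1) := by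
  have h : gaussianReal 0 v = (gaussianReal 0 1).map (fun x => √v * x) := by
    rw [gaussianReal_map_const_mul]
    congr 1
    · simp
    · ext
      simp
  rw [h, lintegral_map (by fun_prop) (by fun_prop), ← lintegral_const_mul _ (by fun_prop)]
  refine lintegral_congr fun x => ?_
  rw [enorm_mul, mul_pow]
  congr 1
  rw [Real.enorm_eq_ofReal (by positivity), ← ENNReal.ofReal_pow (by positivity),
    ← ENNReal.ofReal_coe_nnreal, ← ENNReal.ofReal_pow (by positivity)]
  congr 1
  rw [show (4 : ℕ) = 2 * 2 from rfl, pow_mul, Real.sq_sqrt (by positivity)]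

lemma lintegral_enorm_pow_four_gaussianReal_ne_top :
    ∫⁻ x, ‖x‖ₑ ^ 4 ∂(gaussianReal 0 1) ≠ ∞ := by
  have h := lintegral_rpow_enorm_lt_top_of_eLpNorm_lt_top (by norm_num) (by norm_num)
    (memLp_id_gaussianReal (μ := 0) (v := 1) 4).eLpNorm_lt_top
  refine ne_of_lt ?_
  convert h with x
  simp only [id, ENNReal.coe_ofNat, ENNReal.toReal_ofNat]
  exact_mod_cast rfl

lemma lintegral_enorm_sub_pow_four {Ω : Type*} {mΩ : MeasurableSpace Ω} {P : Measure Ω}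
    {X : ℝ≥0 → Ω → ℝ} (hX : IsPreBrownianReal X P) (s t : ℝ≥0) :
    ∫⁻ ω, ‖X s ω - X t ω‖ₑ ^ 4 ∂P
      = (nndist (s : ℝ) t) ^ 2 * ∫⁻ x, ‖x‖ₑ ^ 4 ∂(gaussianReal 0 1) := by
  rw [← lintegral_enorm_pow_four_gaussianReal]
  exact (hX.hasLaw_sub s t).lintegral_comp (f := fun x => ‖x‖ₑ ^ 4) (by fun_prop)

/-- Almost surely, the dyadic increments of a pre-Brownian motion decay geometrically. -/
lemma ae_dyadic_increment_le {Ω : Type*} {mΩ : MeasurableSpace Ω} {P : Measure Ω}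
    {X : ℝ≥0 → Ω → ℝ} (hXm : ∀ t, Measurable (X t)) (hX : IsPreBrownianReal X P) :
    ∀ᵐ ω ∂P, ∀ N : ℕ, ∃ C : ℝ, ∀ n k : ℕ, k ≤ N * 2 ^ n →
      |X ((k + 1 : ℕ) / 2 ^ n) ω - X (k / 2 ^ n) ω| ≤ C * (9 / 10) ^ n := by
  refine ae_all_iff.2 fun N => ?_
  set c := ∫⁻ x, ‖x‖ₑ ^ 4 ∂(gaussianReal 0 1) with hc
  -- Level `n` has about `N * 2 ^ n` increments, each with fourth moment `c * 4⁻ⁿ`. The weighted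
  -- expectation is thus geometric with ratio `(10 / 9) ^ 4 / 2 < 1`, which is what permits the rate
  -- `9 / 10`.
  set S : Ω → ℝ≥0∞ := fun ω => ∑' n : ℕ, ∑ k ∈ Finset.range (N * 2 ^ n + 1),
    ENNReal.ofReal (((10 / 9) ^ 4) ^ n) *
      ‖X ((k + 1 : ℕ) / 2 ^ n) ω - X (k / 2 ^ n) ω‖ₑ ^ 4 with hS
  have hSm : Measurable S := by fun_prop
  have hterm (n k : ℕ) : ∫⁻ ω, ENNReal.ofReal (((10 / 9) ^ 4) ^ n) *
      ‖X ((k + 1 : ℕ) / 2 ^ n) ω - X (k / 2 ^ n) ω‖ₑ ^ 4 ∂P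
        = c * ENNReal.ofReal (((10 / 9) ^ 4 / 4) ^ n) := by
    rw [lintegral_const_mul _ (by fun_prop), lintegral_enorm_sub_pow_four hX, ← hc]
    have h1 : nndist (((k + 1 : ℕ) / 2 ^ n : ℝ≥0) : ℝ) ((k / 2 ^ n : ℝ≥0) : ℝ) = (1 / 2) ^ n := by
      ext
      rw [coe_nndist, Real.dist_eq]
      push_cast
      rw [← sub_div, add_sub_cancel_left, abs_of_nonneg (by positivity), one_div_pow]
    have h2 : ((((1 / 2) ^ n : ℝ≥0) : ℝ≥0∞)) ^ 2 = ENNReal.ofReal ((1 / 4) ^ n) := by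
      rw [← ENNReal.coe_pow, ← ENNReal.ofReal_coe_nnreal]
      congr 1
      push_cast
      rw [← pow_mul, mul_comm, pow_mul]
      norm_num
    rw [h1, h2, mul_comm _ c, mul_left_comm, ← ENNReal.ofReal_mul (by positivity), ← mul_pow,
      mul_one_div]
  have hSint : ∫⁻ ω, S ω ∂P ≠ ∞ := by
    rw [hS, lintegral_tsum fun n => by fun_prop]
    have hle (n : ℕ) : ∫⁻ ω, ∑ k ∈ Finset.range (N * 2 ^ n + 1),
        ENNReal.ofReal (((10 / 9) ^ 4) ^ n) *
          ‖X ((k + 1 : ℕ) / 2 ^ n) ω - X (k / 2 ^ n) ω‖ₑ ^ 4 ∂P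
        ≤ c * ENNReal.ofReal ((N + 1) * ((10 / 9) ^ 4 / 2) ^ n) := by
      rw [lintegral_finsetSum _ fun k _ => by fun_prop, Finset.sum_congr rfl fun k _ => hterm n k,
        Finset.sum_const, Finset.card_range, nsmul_eq_mul, mul_left_comm]
      gcongr
      rw [← ENNReal.ofReal_natCast, ← ENNReal.ofReal_mul (by positivity)]
      refine ENNReal.ofReal_le_ofReal ?_
      have h1 : ((10 / 9 : ℝ) ^ 4 / 2) ^ n = 2 ^ n * ((10 / 9) ^ 4 / 4) ^ n := by
        rw [← mul_pow]
        norm_num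
      rw [h1, ← mul_assoc]
      gcongr
      push_cast
      have : (1 : ℝ) ≤ 2 ^ n := one_le_pow₀ (by norm_num)
      linarith
    refine ne_top_of_le_ne_top ?_ (ENNReal.tsum_le_tsum hle)
    rw [ENNReal.tsum_mul_left]
    refine ENNReal.mul_ne_top lintegral_enorm_pow_four_gaussianReal_ne_top ?_
    refine Summable.tsum_ofReal_ne_top ?_
    exact (summable_geometric_of_lt_one (by positivity) (by norm_num)).mul_left _
  filter_upwards [ae_lt_top hSm hSint] with ω hω
  -- The maximum with `1` ensures that the constant is at most its own fourth power, so a fourth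
  -- root can be taken without radicals.
  refine ⟨max 1 (S ω).toReal, fun n k hk => ?_⟩
  have h1 : ENNReal.ofReal (((10 / 9) ^ 4) ^ n) *
      ‖X ((k + 1 : ℕ) / 2 ^ n) ω - X (k / 2 ^ n) ω‖ₑ ^ 4 ≤ S ω :=
    le_trans (Finset.single_le_sum (f := fun k : ℕ => ENNReal.ofReal (((10 / 9) ^ 4) ^ n) *
      ‖X ((k + 1 : ℕ) / 2 ^ n) ω - X (k / 2 ^ n) ω‖ₑ ^ 4) (fun _ _ => zero_le)
      (Finset.mem_range.2 (by omega))) (ENNReal.le_tsum n)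
  set D := |X ((k + 1 : ℕ) / 2 ^ n) ω - X (k / 2 ^ n) ω|
  have h2 : ((10 / 9) ^ 4) ^ n * D ^ 4 ≤ (S ω).toReal := by
    refine (ENNReal.ofReal_le_iff_le_toReal hω.ne).1 ?_
    rw [ENNReal.ofReal_mul (by positivity), ENNReal.ofReal_pow (abs_nonneg _),
      ← Real.enorm_eq_ofReal_abs]
    exact h1
  have h3 : (S ω).toReal ≤ (max 1 (S ω).toReal) ^ 4 :=
    (le_max_right _ _).trans (le_self_pow₀ (le_max_left _ _) (by norm_num))
  have h4 : ((10 / 9) ^ n * D) ^ 4 ≤ (max 1 (S ω).toReal) ^ 4 := by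
    rw [mul_pow, ← pow_mul, mul_comm n, pow_mul]
    exact h2.trans h3
  have h5 := le_of_pow_le_pow_left₀ (by norm_num) (by positivity) h4
  calc D = (10 / 9) ^ n * D * (9 / 10) ^ n := by
        rw [mul_right_comm, ← mul_pow]
        norm_num
    _ ≤ _ := by gcongr

/-- A pre-Brownian motion is almost surely the limit of its values at the dyadic approximations
of the time. -/
lemma ae_tendsto_dyadic {Ω : Type*} {mΩ : MeasurableSpace Ω} {P : Measure Ω}
    {X : ℝ≥0 → Ω → ℝ} (hXm : ∀ t, Measurable (X t)) (hX : IsPreBrownianReal X P) (t : ℝ≥0) :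
    ∀ᵐ ω ∂P, Tendsto (fun n : ℕ => X (⌊2 ^ n * t⌋₊ / 2 ^ n) ω) atTop (𝓝 (X t ω)) := by
  -- The approximation error in time is at most `2⁻ⁿ`, so the expected fourth powers are summable;
  -- almost surely the terms tend to zero.
  set S : Ω → ℝ≥0∞ := fun ω => ∑' n : ℕ, ‖X (⌊2 ^ n * t⌋₊ / 2 ^ n) ω - X t ω‖ₑ ^ 4 with hS
  have hSm : Measurable S := by fun_prop
  have hSint : ∫⁻ ω, S ω ∂P ≠ ∞ := by
    rw [hS, lintegral_tsum fun n => by fun_prop]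
    simp_rw [lintegral_enorm_sub_pow_four hX]
    rw [ENNReal.tsum_mul_right]
    refine ENNReal.mul_ne_top ?_ lintegral_enorm_pow_four_gaussianReal_ne_top
    have hle (n : ℕ) : (nndist (((⌊2 ^ n * t⌋₊ / 2 ^ n : ℝ≥0)) : ℝ) t : ℝ≥0∞) ^ 2
        ≤ ENNReal.ofReal ((1 / 4) ^ n) := by
      rw [← ENNReal.coe_pow, ← ENNReal.ofReal_coe_nnreal]
      refine ENNReal.ofReal_le_ofReal ?_
      have h1 : (⌊2 ^ n * t⌋₊ : ℝ≥0) ≤ 2 ^ n * t := Nat.floor_le (by positivity)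
      have h2 : 2 ^ n * t < ⌊2 ^ n * t⌋₊ + 1 := Nat.lt_floor_add_one _
      rw [← NNReal.coe_le_coe] at h1
      rw [← NNReal.coe_lt_coe] at h2
      push_cast at h1 h2 ⊢
      have h3 : dist ((⌊2 ^ n * t⌋₊ : ℝ) / 2 ^ n) t ≤ (1 / 2) ^ n := by
        have h2n : (0 : ℝ) < 2 ^ n := by positivity
        rw [Real.dist_eq, abs_sub_comm, abs_of_nonneg, one_div_pow, le_div_iff₀ h2n, sub_mul,
          div_mul_cancel₀ _ h2n.ne']
        · linarith
        · rw [sub_nonneg, div_le_iff₀ h2n]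
          linarith
      calc dist ((⌊2 ^ n * t⌋₊ : ℝ) / 2 ^ n) t ^ 2 ≤ ((1 / 2) ^ n) ^ 2 := by gcongr
        _ = (1 / 4) ^ n := by rw [← pow_mul, mul_comm, pow_mul]; norm_num
    refine ne_top_of_le_ne_top ?_ (ENNReal.tsum_le_tsum hle)
    exact (summable_geometric_of_lt_one (by norm_num) (by norm_num)).tsum_ofReal_ne_top
  filter_upwards [ae_lt_top hSm hSint] with ω hω
  have h1 := ENNReal.tendsto_atTop_zero_of_tsum_ne_top hω.ne
  rw [tendsto_iff_edist_tendsto_0]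
  have h2 := (ENNReal.continuous_rpow_const (y := 1 / 4)).tendsto 0 |>.comp h1
  refine (h2.congr fun n => ?_).trans (by simp)
  rw [Function.comp_apply, edist_eq_enorm_sub, ← ENNReal.rpow_natCast, ← ENNReal.rpow_mul]
  norm_num

/-- There is a Brownian motion. -/
theorem exists_isBrownianReal :
    ∃ (Ω : Type) (_ : MeasurableSpace Ω) (P : Measure Ω) (Y : ℝ≥0 → Ω → ℝ),
      (∀ t, Measurable (Y t)) ∧ IsBrownianReal Y P := by
  obtain ⟨Ω, mΩ, P, X, hXm, hX⟩ := exists_isPreBrownianReal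
  have hlim : ∀ᵐ ω ∂P, ∃ y : ℝ≥0 → ℝ, Continuous y ∧
      ∀ t, Tendsto (fun n : ℕ => X (⌊2 ^ n * t⌋₊ / 2 ^ n) ω) atTop (𝓝 (y t)) := by
    filter_upwards [ae_dyadic_increment_le hXm hX] with ω hω
    exact exists_continuous_dyadic_limit (x := (X · ω)) (by norm_num) (by norm_num) hω
  -- Unlike the limit, the `limsup` is defined and measurable everywhere; it agrees with the limit
  -- almost surely.
  refine ⟨Ω, mΩ, P, fun t ω => limsup (fun n : ℕ => X (⌊2 ^ n * t⌋₊ / 2 ^ n) ω) atTop,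
    fun t => Measurable.limsup fun n => hXm _, hX.congr fun t => ?_, ?_⟩
  · filter_upwards [ae_tendsto_dyadic hXm hX t] with ω hω
    exact hω.limsup_eq.symm
  · filter_upwards [hlim] with ω ⟨y, hy, hyt⟩
    convert hy using 2 with t
    exact (hyt t).limsup_eq

/-! ### Augmented filtration and the usual conditions -/

/-- The natural filtration of a process on a complete probability space, augmented by the null
sets. -/
def augmentedFiltration {Ω : Type*} {mΩ : MeasurableSpace Ω} (P : Measure Ω) [P.IsComplete]
    (Y : ℝ≥0 → Ω → ℝ) (hY : ∀ t, StronglyMeasurable (Y t)) : Filtration ℝ≥0 mΩ where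
  seq t := @eventuallyMeasurableSpace Ω (Filtration.natural Y hY t) (ae P) _
  mono' _ _ hst _ := fun ⟨B, hB, hAB⟩ => ⟨B, (Filtration.natural Y hY).mono hst B hB, hAB⟩
  le' t _ := fun ⟨B, hB, hAB⟩ => NullMeasurableSet.measurable_of_complete
    ⟨B, (Filtration.natural Y hY).le t B hB, hAB⟩

lemma measurableSet_augmentedFiltration {Ω : Type*} {mΩ : MeasurableSpace Ω} {P : Measure Ω}
    [P.IsComplete] {Y : ℝ≥0 → Ω → ℝ} {hY : ∀ t, StronglyMeasurable (Y t)} {t : ℝ≥0} {A : Set Ω} :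
    MeasurableSet[augmentedFiltration P Y hY t] A ↔
      ∃ B, MeasurableSet[Filtration.natural Y hY t] B ∧ A =ᵐ[P] B :=
  Iff.rfl

lemma natural_le_augmentedFiltration {Ω : Type*} {mΩ : MeasurableSpace Ω} {P : Measure Ω}
    [P.IsComplete] {Y : ℝ≥0 → Ω → ℝ} (hY : ∀ t, StronglyMeasurable (Y t)) :
    Filtration.natural Y hY ≤ augmentedFiltration P Y hY := fun _ A hA =>
  measurableSet_augmentedFiltration.2 ⟨A, hA, EventuallyEq.rfl⟩

lemma usualConditions_rightCont_augmentedFiltration {Ω : Type*} {mΩ : MeasurableSpace Ω}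
    {P : Measure Ω} [P.IsComplete] {Y : ℝ≥0 → Ω → ℝ} (hY : ∀ t, StronglyMeasurable (Y t)) :
    UsualConditions (augmentedFiltration P Y hY).rightCont P where
  complete := inferInstance
  null_mem A hA := (augmentedFiltration P Y hY).le_rightCont 0 A
    (measurableSet_augmentedFiltration.2
      ⟨∅, @MeasurableSet.empty _ (Filtration.natural Y hY 0), ae_eq_empty.2 hA⟩)
  rightContinuous := inferInstance

/-- The increments of a Brownian motion are independent of the right-continuous augmented past. -/
lemma indep_increment_rightCont {Ω : Type*} {mΩ : MeasurableSpace Ω} {P : Measure Ω}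
    [P.IsComplete] {Y : ℝ≥0 → Ω → ℝ} (hY : ∀ t, StronglyMeasurable (Y t))
    (hB : IsBrownianReal Y P) {s t : ℝ≥0} (hst : s ≤ t) :
    Indep ((augmentedFiltration P Y hY).rightCont s)
      (MeasurableSpace.comap (fun ω => Y t ω - Y s ω) inferInstance) P := by
  have : IsProbabilityMeasure P := hB.isGaussianProcess.isProbabilityMeasure
  have hYm (r : ℝ≥0) : Measurable (Y r) := (hY r).measurable
  refine indep_comap_of_bcf (Filtration.le _ s) (by fun_prop) fun A hA f => ?_
  -- An event of the right limit at `s` belongs to the augmented past at each later time `s + 1 / (n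
  -- + 1)`.
  have hA' (n : ℕ) : MeasurableSet[augmentedFiltration P Y hY (s + 1 / (n + 1))] A := by
    rw [Filtration.rightCont_eq] at hA
    exact (iInf₂_le (s + 1 / (n + 1) : ℝ≥0) (by simp) :
      (⨅ j > s, augmentedFiltration P Y hY j) ≤ _) A hA
  -- Up to a null set, `A` is a natural event at the shifted time, and the shifted increment is
  -- independent of it. Continuity of paths and dominated convergence then remove the shift.
  have heq (n : ℕ) : ∫ ω in A, f (Y (t + 1 / (n + 1)) ω - Y (s + 1 / (n + 1)) ω) ∂P
      = P.real A * ∫ ω, f (Y (t + 1 / (n + 1)) ω - Y (s + 1 / (n + 1)) ω) ∂P := by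
    obtain ⟨B, hBm, hAB⟩ := measurableSet_augmentedFiltration.1 (hA' n)
    rw [setIntegral_congr_set hAB, measureReal_congr hAB]
    refine Indep.setIntegral_eq_mul (Filtration.le (Filtration.natural Y hY) _) ?_
      (by fun_prop) hBm f.continuous.aestronglyMeasurable
    have h1 := (hB.indepFun_shift (s + 1 / (n + 1))).symm
    rw [IndepFun_iff_Indep, ← Filtration.natural_eq_comap Y hY] at h1
    refine indep_of_indep_of_le_right h1 ?_
    have h2 : (fun ω => Y (t + 1 / (n + 1)) ω - Y (s + 1 / (n + 1)) ω) =
        (fun y : ℝ≥0 → ℝ => y (t - s)) ∘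
          fun ω r => Y (s + 1 / (n + 1) + r) ω - Y (s + 1 / (n + 1)) ω := by
      funext ω
      simp only [Function.comp_apply]
      rw [add_right_comm, add_tsub_cancel_of_le hst]
    rw [h2, ← MeasurableSpace.comap_comp]
    exact MeasurableSpace.comap_mono (measurable_pi_apply _).comap_le
  have hε : Tendsto (fun n : ℕ => (1 / (n + 1) : ℝ≥0)) atTop (𝓝 0) :=
    tendsto_one_div_add_atTop_nhds_zero_nat
  have hlim : ∀ᵐ ω ∂P, Tendsto (fun n : ℕ => f (Y (t + 1 / (n + 1)) ω - Y (s + 1 / (n + 1)) ω))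
      atTop (𝓝 (f (Y t ω - Y s ω))) := by
    filter_upwards [hB.cont] with ω hω
    have h (r : ℝ≥0) : Tendsto (fun n : ℕ => Y (r + 1 / (n + 1)) ω) atTop (𝓝 (Y r ω)) := by
      refine (hω.tendsto r).comp ?_
      simpa using hε.const_add r
    exact (f.continuous.tendsto _).comp ((h t).sub (h s))
  have hfm (n : ℕ) : AEStronglyMeasurable
      (fun ω => f (Y (t + 1 / (n + 1)) ω - Y (s + 1 / (n + 1)) ω)) P :=
    f.continuous.comp_aestronglyMeasurable (by fun_prop)
  have h1 : Tendsto (fun n : ℕ => ∫ ω in A, f (Y (t + 1 / (n + 1)) ω - Y (s + 1 / (n + 1)) ω) ∂P)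
      atTop (𝓝 (∫ ω in A, f (Y t ω - Y s ω) ∂P)) :=
    tendsto_integral_of_dominated_convergence (fun _ => ‖f‖) (fun n => (hfm n).restrict)
      (integrable_const _) (fun n => ae_of_all _ fun ω => f.norm_coe_le_norm _)
      (ae_restrict_of_ae hlim)
  have h2 : Tendsto (fun n : ℕ => ∫ ω, f (Y (t + 1 / (n + 1)) ω - Y (s + 1 / (n + 1)) ω) ∂P)
      atTop (𝓝 (∫ ω, f (Y t ω - Y s ω) ∂P)) :=
    tendsto_integral_of_dominated_convergence (fun _ => ‖f‖) hfm
      (integrable_const _) (fun n => ae_of_all _ fun ω => f.norm_coe_le_norm _) hlim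
  exact tendsto_nhds_unique h1 ((h2.const_mul (P.real A)).congr fun n => (heq n).symm)

/-- The identity from the completed space to the original one preserves measure, and both have the
same null sets. -/
lemma isBrownianReal_completion {Ω : Type*} {mΩ : MeasurableSpace Ω} {P : Measure Ω}
    {Y : ℝ≥0 → Ω → ℝ} (hB : IsBrownianReal Y P) :
    IsBrownianReal (Ω := NullMeasurableSpace Ω P) Y P.completion where
  hasLaw I := by
    let c : NullMeasurableSpace Ω P → Ω := fun ω => ω
    have hc : Measurable c := fun A hA => (hA.nullMeasurableSet : NullMeasurableSet A P)
    have hmp : MeasurePreserving c P.completion P :=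
      ⟨hc, Measure.ext fun A hA => by rw [Measure.map_apply hc hA]; rfl⟩
    exact (hB.hasLaw I).comp hmp.hasLaw
  cont := hB.cont

/-- There is a one-dimensional Brownian motion on a filtered probability space satisfying the
usual conditions. -/
theorem exists_isBrownianMotion :
    ∃ (Ω : Type) (mΩ : MeasurableSpace Ω) (F : Filtration ℝ≥0 mΩ) (P : Measure Ω)
      (W : ℝ≥0 → Ω → (Fin 1 → ℝ)),
      IsProbabilityMeasure P ∧ UsualConditions F P ∧ IsBrownianMotion F P W := by
  obtain ⟨Ω, mΩ, P, Y, hYm, hB⟩ := exists_isBrownianReal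
  have hB' := isBrownianReal_completion hB
  have hP : IsProbabilityMeasure P.completion := hB'.isGaussianProcess.isProbabilityMeasure
  have hY (t : ℝ≥0) : StronglyMeasurable (α := NullMeasurableSpace Ω P) (Y t) :=
    Measurable.stronglyMeasurable fun A hA => (hYm t hA).nullMeasurableSet
  refine ⟨NullMeasurableSpace Ω P, inferInstance, (augmentedFiltration P.completion Y hY).rightCont,
    P.completion, fun t ω _ => Y t ω, hP, usualConditions_rightCont_augmentedFiltration hY, ?_⟩
  refine ⟨fun t => ?_, fun _ => hB', iIndepFun.of_subsingleton, fun s t hst => ?_⟩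
  · refine @measurable_pi_lambda _ _ _ (_) _ _ fun _ => ?_
    exact ((Filtration.stronglyAdapted_natural hY t).measurable.mono
      (natural_le_augmentedFiltration hY t) le_rfl).mono
      ((augmentedFiltration P.completion Y hY).le_rightCont t) le_rfl
  · refine indep_of_indep_of_le_left (indep_increment_rightCont hY hB' hst).symm ?_
    refine Measurable.comap_le ?_
    refine @measurable_pi_lambda _ _ _ (_) _ _ fun _ => ?_
    exact comap_measurable _

/-! ### The counterexample -/

/-- The simple integrand `1_{(0, n]}`. -/
def SimpleIntegrand.one {Ω : Type*} {mΩ : MeasurableSpace Ω} (F : Filtration ℝ≥0 mΩ) (n : ℕ) :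
    SimpleIntegrand F where
  n := 1
  τ k := k * n
  ξ _ _ := 1
  mono _ _ h := mul_le_mul_left (Nat.cast_le.2 h) _
  measurable _ := measurable_const
  bounded := ⟨1, by simp⟩

lemma SimpleIntegrand.one_toFun {Ω : Type*} {mΩ : MeasurableSpace Ω} {F : Filtration ℝ≥0 mΩ}
    {n : ℕ} {t : ℝ≥0} (h0 : 0 < t) (ht : t ≤ n) (ω : Ω) : (one F n).toFun t ω = 1 := by
  simp [toFun, one, h0, ht]

lemma SimpleIntegrand.one_integral {Ω : Type*} {mΩ : MeasurableSpace Ω} {F : Filtration ℝ≥0 mΩ}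
    (B : ℝ≥0 → Ω → ℝ) {n : ℕ} {t : ℝ≥0} (ht : t ≤ n) (ω : Ω) :
    (one F n).integral B t ω = B t ω - B 0 ω := by
  simp [integral, one, ht]

/-- The Itô integral of the constant `1` with respect to `B` is `B`. -/
lemma isItoIntegral_one {Ω : Type*} {mΩ : MeasurableSpace Ω} {F : Filtration ℝ≥0 mΩ}
    {P : Measure Ω} {B : ℝ≥0 → Ω → ℝ} (hB : IsBrownianReal B P) (hF : Adapted F B) :
    IsItoIntegral F P B (fun _ _ => 1) B where
  progressive := isProgressive_const F 1
  sq_integrable := ae_of_all _ fun ω t => by simp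
  adapted := hF
  continuous := hB.cont
  approx := by
    refine ⟨SimpleIntegrand.one F, fun t ε hε => ?_, fun t ε hε => ?_⟩
    · refine tendsto_const_nhds.congr' ?_
      filter_upwards [eventually_ge_atTop ⌈t⌉₊] with n hn
      have htn : t ≤ n := Nat.ceil_le.1 hn
      have h (ω : Ω) : ∫⁻ s in Set.Ioc (0 : ℝ) t,
          ENNReal.ofReal (((SimpleIntegrand.one F n).toFun s.toNNReal ω - 1) ^ 2) = 0 := by
        rw [setLIntegral_congr_fun (g := fun _ => 0) measurableSet_Ioc fun s hs => ?_]
        · simp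
        · simp only
          rw [SimpleIntegrand.one_toFun (Real.toNNReal_pos.2 hs.1)
            ((Real.toNNReal_le_iff_le_coe.2 hs.2).trans htn)]
          simp
      simp [h, hε.ne']
    · refine tendsto_const_nhds.congr' ?_
      filter_upwards [eventually_ge_atTop ⌈t⌉₊] with n hn
      have htn : t ≤ n := Nat.ceil_le.1 hn
      -- For `n ≥ t` the elementary integral is exactly `B t - B 0`, so the only possible
      -- discrepancy lies in the null set where `B 0 ≠ 0`.
      refine (measure_mono_null (fun ω hω => ?_) (ae_iff.1 hB.eval_zero_ae_eq_zero)).symm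
      intro h0
      rw [Set.mem_ofPred_eq, SimpleIntegrand.one_integral B htn, h0, sub_zero, edist_self] at hω
      exact hε.not_ge hω

lemma brownianSystem_drift {m : ℕ} (U : Set (Fin m → ℝ)) (x : Fin 1 → ℝ) (u : Fin m → ℝ) :
    (brownianSystem U).drift x u = 0 := by
  simp [ControlSystem.drift, brownianSystem]

lemma hessian_identityBarrier (x : Fin 1 → ℝ) : hessian identityBarrier x = 0 := by
  have h (y : Fin 1 → ℝ) : fderiv ℝ identityBarrier y = ContinuousLinearMap.proj 0 :=
    (ContinuousLinearMap.proj (R := ℝ) (φ := fun _ : Fin 1 => ℝ) 0).fderiv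
  ext i j
  simp [hessian, h]

lemma zcbfInequality_brownianSystem_iff {m : ℕ} (U : Set (Fin m → ℝ)) (x : Fin 1 → ℝ)
    (u : Fin m → ℝ) :
    ZCBFInequality (brownianSystem U) identityBarrier x u ↔ 0 ≥ -identityBarrier x := by
  simp [ZCBFInequality, brownianSystem_drift, hessian_identityBarrier]

lemma isZCBF_identityBarrier {m : ℕ} {U : Set (Fin m → ℝ)} (hU : U.Nonempty) :
    IsZCBF (brownianSystem U) identityBarrier where
  contDiffOn := (contDiff_apply ℝ ℝ (0 : Fin 1)).contDiffOn
  exists_control x _ hx := by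
    obtain ⟨u, hu⟩ := hU
    exact ⟨u, hu, (zcbfInequality_brownianSystem_iff U x u).2 (neg_nonpos.2 hx.le)⟩

lemma safeSet_brownianSystem {m : ℕ} (U : Set (Fin m → ℝ)) :
    safeSet (brownianSystem U) identityBarrier = {x | x 0 ≥ 0} := by
  ext x
  simp [safeSet, brownianSystem, identityBarrier]

lemma isSolution_brownianSystem {Ω : Type*} {mΩ : MeasurableSpace Ω} {F : Filtration ℝ≥0 mΩ}
    {P : Measure Ω} {W : ℝ≥0 → Ω → (Fin 1 → ℝ)} (hW : IsBrownianMotion F P W) {m : ℕ}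
    (U : Set (Fin m → ℝ)) (u : ℝ≥0 → Ω → (Fin m → ℝ)) :
    IsSolution (brownianSystem U) F P W u W where
  adapted := hW.adapted
  continuous := by
    filter_upwards [(hW.coord 0).cont] with ω hω
    refine continuous_pi fun i => ?_
    rwa [Subsingleton.elim i 0]
  mem := ae_of_all _ fun _ _ => Set.mem_univ _
  drift_integrable := ae_of_all _ fun ω t i => by simp [brownianSystem_drift]
  integral_eq := by
    refine ⟨fun _ j t ω => W t ω j, fun i j => ?_, ?_⟩
    · have h : (fun (t : ℝ≥0) ω => (brownianSystem U).σ (W t ω) i j) = fun _ _ => 1 := by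
        simp [brownianSystem, Subsingleton.elim i j]
      rw [h]
      exact isItoIntegral_one (hW.coord j) fun t => (measurable_pi_apply j).comp (hW.adapted t)
    · filter_upwards [(hW.coord 0).eval_zero_ae_eq_zero] with ω hω t i
      simp [brownianSystem_drift, Subsingleton.elim i 0, hω]

/-- Brownian motion is not almost surely nonnegative. -/
lemma measure_forall_nonneg_ne_one {Ω : Type*} {mΩ : MeasurableSpace Ω} {P : Measure Ω}
    {B : ℝ≥0 → Ω → ℝ} (hB : IsPreBrownianReal B P) : P {ω | ∀ t : ℝ≥0, B t ω ≥ 0} ≠ 1 := by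
  intro h
  have hlaw := hB.hasLaw_eval 1
  -- Only the inclusion into the event at time `1` is used, so the path event need not be
  -- measurable.
  have h1 : 1 ≤ gaussianReal 0 1 (Set.Ici 0) := by
    rw [← h, ← hlaw.map_eq, Measure.map_apply_of_aemeasurable hlaw.aemeasurable measurableSet_Ici]
    exact measure_mono fun ω hω => hω 1
  have h2 : gaussianReal 0 1 (Set.Iio 0) = 0 := by
    rw [← Set.compl_Ici, prob_compl_eq_zero_iff measurableSet_Ici]
    exact le_antisymm prob_le_one h1
  -- Lebesgue measure is absolutely continuous with respect to a nondegenerate Gaussian, so the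
  -- negative half-line would be Lebesgue-null.
  have h3 := gaussianReal_absolutelyContinuous' 0 one_ne_zero h2
  simp at h3

lemma not_almostSureSafety_brownianSystem {m : ℕ} {U : Set (Fin m → ℝ)} (hU : U.Nonempty) :
    ¬ AlmostSureSafety (brownianSystem U) identityBarrier := by
  intro hsafe
  obtain ⟨Ω, mΩ, F, P, W, hP, hF, hW⟩ := exists_isBrownianMotion
  obtain ⟨u, hu⟩ := hU
  -- Any constant control is admissible, since neither the dynamics nor the inequality depends on
  -- it.
  have h := hsafe Ω mΩ F P hP hF W (fun _ _ => u) W hW ⟨isProgressive_const F u, fun _ _ => hu⟩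
    (isSolution_brownianSystem hW U _)
    (ae_of_all _ fun ω t ht => (zcbfInequality_brownianSystem_iff U _ _).2 (neg_nonpos.2 ht.le)) ?_
  · rw [safeSet_brownianSystem] at h
    exact measure_forall_nonneg_ne_one (hW.coord 0).toIsPreBrownianReal h
  · filter_upwards [(hW.coord 0).eval_zero_ae_eq_zero] with ω hω
    rw [safeSet_brownianSystem]
    exact hω.ge

end StochCBF

open StochCBF
theorem mainTheorem4 :
    (∀ (m : ℕ) (U : Set (Fin m → ℝ)), U.Nonempty →
      IsZCBF (brownianSystem U) identityBarrier ∧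
      (∀ (x : Fin 1 → ℝ) (u : Fin m → ℝ),
        ZCBFInequality (brownianSystem U) identityBarrier x u ↔ 0 ≥ -identityBarrier x) ∧
      safeSet (brownianSystem U) identityBarrier = {x | x 0 ≥ 0} ∧
      (∀ (Ω : Type*) (mΩ : MeasurableSpace Ω) (F : Filtration ℝ≥0 mΩ) (P : Measure Ω),
        IsProbabilityMeasure P → UsualConditions F P →
        ∀ (W : ℝ≥0 → Ω → (Fin 1 → ℝ)), IsBrownianMotion F P W →
          (∀ u : ℝ≥0 → Ω → (Fin m → ℝ), IsControl (brownianSystem U) F u →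
            IsSolution (brownianSystem U) F P W u W ∧
            ControlSatisfiesZCBF (brownianSystem U) identityBarrier P u W) ∧
          (∀ᵐ ω ∂P, W 0 ω ∈ safeSet (brownianSystem U) identityBarrier) ∧
          (∀ t : ℝ≥0, HasLaw (fun ω => W t ω 0) (gaussianReal 0 t) P) ∧
          P {ω | ∀ t : ℝ≥0, W t ω 0 ≥ 0} ≠ 1) ∧
      ¬ AlmostSureSafety (brownianSystem U) identityBarrier) ∧
    ¬ ZCBFSafetyClaim := by
  refine ⟨fun m U hU => ⟨isZCBF_identityBarrier hU, zcbfInequality_brownianSystem_iff U,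
    safeSet_brownianSystem U, ?_, not_almostSureSafety_brownianSystem hU⟩, fun hclaim =>
    not_almostSureSafety_brownianSystem (m := 0) Set.univ_nonempty
      (hclaim 1 0 1 _ _ (isZCBF_identityBarrier Set.univ_nonempty))⟩
  intro Ω mΩ F P hP hF W hW
  refine ⟨fun u hu => ⟨isSolution_brownianSystem hW U u, ae_of_all _ fun ω t ht =>
    (zcbfInequality_brownianSystem_iff U _ _).2 (neg_nonpos.2 ht.le)⟩, ?_,
    fun t => (hW.coord 0).hasLaw_eval t,
    measure_forall_nonneg_ne_one (hW.coord 0).toIsPreBrownianReal⟩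
  filter_upwards [(hW.coord 0).eval_zero_ae_eq_zero] with ω hω
  rw [safeSet_brownianSystem]
  exact hω.ge
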